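/- Let $G$ be a (finite-dimensional, real, smooth) Lie group of even dimension, and let $\langle\cdot,\cdot\rangle$ be a left-invariant Riemannian metric on $G$ which is flat, i.e. the curvature $R(X,Y)Z=\nabla_X\nabla_YZ-\nabla_Y\nabla_XZ-\nabla_{[X,Y]}Z$ of its Levi-Civita connection $\nabla$ vanishes for all smooth vector fields $X,Y,Z$. Then there exists a left-invariant smooth differential 2-form $\Omega$ on $G$ such that $(G,\langle\cdot,\cdot\rangle,\Omega)$ is a Kähler Lie group, in the sense that $\Omega$ is nondegenerate and parallel, $\nabla\Omega=0$; that is, $$X\cdot\Omega(Y,Z)=\Omega(\nabla_XY,Z)+\Omega(Y,\nabla_XZ)$$ for all smooth vector fields $X,Y,Z$ on $G$. -/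

import Mathlib

open scoped Manifold ContDiff Bundle

noncomputable section

namespace RiemannianLieGroup

section Manifold

variable {E : Type*} [NormedAddCommGroup E] [NormedSpace ℝ E]
  {H : Type*} [TopologicalSpace H] (I : ModelWithCorners ℝ E H)
  (M : Type*) [TopologicalSpace M] [ChartedSpace H M] [IsManifold I ∞ M]

/-- Smooth Riemannian metrics on the manifold `M`. -/
abbrev Metric : Type _ :=
  Bundle.ContMDiffRiemannianMetric I ∞ E (fun x : M ↦ TangentSpace I x)

/-- Affine connections on `M`, i.e. covariant derivatives on its tangent bundle.
For `nabla : Connection I M`, the vector `nabla Y x u` is `∇_u Y` at `x`, for `u` tangent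
at `x`. -/
abbrev Connection : Type _ :=
  CovariantDerivative I E (fun x : M ↦ TangentSpace I x)

/-- Smooth differential 2-forms on `M`. -/
structure TwoForm where
  /-- The bilinear form on each tangent space. -/
  form (x : M) : TangentSpace I x →L[ℝ] TangentSpace I x →L[ℝ] ℝ
  alternating (x : M) (u : TangentSpace I x) : form x u u = 0
  contMDiff : ContMDiff I (I.prod 𝓘(ℝ, E →L[ℝ] E →L[ℝ] ℝ)) ∞
    (fun x ↦ Bundle.TotalSpace.mk' (E →L[ℝ] E →L[ℝ] ℝ)
      (E := fun x : M ↦ TangentSpace I x →L[ℝ] TangentSpace I x →L[ℝ] ℝ) x (form x))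

variable {I M}

/-- Smooth vector fields. -/
def IsSmoothField (X : Π x : M, TangentSpace I x) : Prop :=
  ContMDiff I I.tangent ∞ (fun x ↦ (⟨x, X x⟩ : TangentBundle I M))

/-- Nondegeneracy: only the zero tangent vector pairs to zero with all tangent vectors. -/
def TwoForm.Nondegenerate (Ω : TwoForm I M) : Prop :=
  ∀ (x : M) (u : TangentSpace I x), (∀ v : TangentSpace I x, Ω.form x u v = 0) → u = 0

/-- The 2-form is parallel, `∇Ω = 0`: for all smooth vector fields `X`, `Y`, `Z`,
`X · Ω(Y, Z) = Ω(∇_X Y, Z) + Ω(Y, ∇_X Z)`. -/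
def TwoForm.IsParallel (Ω : TwoForm I M) (nabla : Connection I M) : Prop :=
  ∀ X Y Z : Π x : M, TangentSpace I x, IsSmoothField X → IsSmoothField Y → IsSmoothField Z →
    ∀ x : M, mvfderiv I (fun y ↦ Ω.form y (Y y) (Z y)) x (X x)
      = Ω.form x (nabla Y x (X x)) (Z x) + Ω.form x (Y x) (nabla Z x (X x))

/-- The curvature
`R(X, Y) Z = ∇_X ∇_Y Z - ∇_Y ∇_X Z - ∇_[X, Y] Z` of a connection, at the point `x`. -/
def curvature (nabla : Connection I M) (X Y Z : Π x : M, TangentSpace I x) (x : M) :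
    TangentSpace I x :=
  nabla (fun y ↦ nabla Z y (Y y)) x (X x) - nabla (fun y ↦ nabla Z y (X y)) x (Y x)
    - nabla Z x (VectorField.mlieBracket I X Y x)

variable [FiniteDimensional ℝ E]

/-- `nabla` is the Levi-Civita connection of `g`: it is compatible with `g`, that is,
`X · g(Y, Z) = g(∇_X Y, Z) + g(Y, ∇_X Z)` for all smooth vector fields `X`, `Y`, `Z`, and it is
torsion free. These two properties determine `∇_X Y` for all smooth `X` and `Y`. -/
def IsLeviCivita (g : Metric I M) (nabla : Connection I M) : Prop :=
  haveI : CompleteSpace E := FiniteDimensional.complete ℝ E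
  (∀ X Y Z : Π x : M, TangentSpace I x, IsSmoothField X → IsSmoothField Y → IsSmoothField Z →
    ∀ x : M, mvfderiv I (fun y ↦ g.inner y (Y y) (Z y)) x (X x)
      = g.inner x (nabla Y x (X x)) (Z x) + g.inner x (Y x) (nabla Z x (X x))) ∧
  nabla.torsion = 0

/-- The metric `g` is flat: the curvature of its Levi-Civita connection vanishes. -/
def IsFlat (g : Metric I M) : Prop :=
  ∃ nabla : Connection I M, IsLeviCivita g nabla ∧
    ∀ X Y Z : Π x : M, TangentSpace I x, IsSmoothField X → IsSmoothField Y → IsSmoothField Z →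
      ∀ x : M, curvature nabla X Y Z x = 0

/-- `(M, g, Ω)` is a Kähler manifold: the 2-form `Ω` is nondegenerate, and parallel for the
Levi-Civita connection of `g`. -/
def IsKahler (g : Metric I M) (Ω : TwoForm I M) : Prop :=
  Ω.Nondegenerate ∧ ∃ nabla : Connection I M, IsLeviCivita g nabla ∧ Ω.IsParallel nabla

end Manifold

section LieGroup

variable {E : Type*} [NormedAddCommGroup E] [NormedSpace ℝ E]
  {H : Type*} [TopologicalSpace H] {I : ModelWithCorners ℝ E H}
  {G : Type*} [TopologicalSpace G] [ChartedSpace H G] [Group G]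

/-- A field of bilinear forms on the tangent spaces of `G` is left invariant if it is preserved by
the differentials of all left translations `b ↦ a * b`. -/
def IsLeftInvariant (B : Π x : G, TangentSpace I x →L[ℝ] TangentSpace I x →L[ℝ] ℝ) : Prop :=
  ∀ (a b : G) (u v : TangentSpace I b),
    B (a * b) (mfderiv I I (fun c ↦ a * c) b u) (mfderiv I I (fun c ↦ a * c) b v) = B b u v

end LieGroup

end RiemannianLieGroup

end

/-!
A left-invariant flat metric on `G` is studied through the product `D u v = ∇_u v` on the Lie
algebra `𝔤`. Koszul's formula (`IsLeviCivita.koszul`) shows that the covariant derivative of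
left-invariant fields is left-invariant, so that `D` records all of `∇`: every `D u` is skew,
`[u, v] = D u v - D v u`, and flatness says that `D [u, v] = [D u, D v]`
(`IsLeviCivita.leftProduct_flat`).

The operators `D u` commute with each other (`flatProduct_commute`). Let `W` be the orthogonal
complement of the kernel of `D`. It is stable under all `D u`, and `-tr (D u * D v)` is a positive
definite invariant form on `W`. With an orthogonal basis `e i` of `W` for this form, normalised by
positive weights `c i`, put `C = ∑ c i * (D (e i))²` and `w = ∑ c i * D (e i) (e i)`. The identity
map of `W` is a 1-cocycle for the representation `D`, and the computation which proves Whitehead's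
lemma gives `D x w = C x` for `x` in `W`. By skewness `⟪x, C w⟫ = ⟪C x, w⟫ = ⟪D x w, w⟫ = 0`, so
`C w = 0`, which forces `D x w = 0` for all `x`, then `C = 0`, then `D = 0` on `W`
(`flatProduct_eq_zero`). Hence `[W, W] = 0`, and since only the component in `W` matters for
`D u`, the operators `D u` commute.

A commuting family of skew maps of an even-dimensional Euclidean space commutes with some
invertible skew map `J` (`exists_isSkew_ker_eq_bot_commute`): a `J` with the smallest possible
kernel is invertible. The form `-⟪J u, v⟫` is alternating, nondegenerate and killed by every
`D x`. Extended to a left-invariant form on `G`, it is parallel along left-invariant fields. As the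
equation `∇Ω = 0` is tensorial in the two arguments of `Ω`, and left-invariant fields take all
values at each point, it holds for all fields (`TwoForm.isParallel_of_spanning`).
-/

noncomputable section

namespace RiemannianLieGroup

open Bundle Module
open scoped InnerProductSpace

/-! ### Skew-adjoint maps of a Euclidean space -/

section SkewMaps

variable {V : Type*} [NormedAddCommGroup V] [InnerProductSpace ℝ V]

/-- An endomorphism is skew-adjoint for the inner product. -/
def IsSkew (A : V →ₗ[ℝ] V) : Prop := ∀ x y, ⟪A x, y⟫_ℝ = -⟪x, A y⟫_ℝ

theorem IsSkew.inner_self {A : V →ₗ[ℝ] V} (hA : IsSkew A) (x : V) : ⟪A x, x⟫_ℝ = 0 := by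
  have h := hA x x
  rw [real_inner_comm] at h
  rw [real_inner_comm]
  linarith

theorem IsSkew.adjoint_eq [FiniteDimensional ℝ V] {A : V →ₗ[ℝ] V} (hA : IsSkew A) :
    LinearMap.adjoint A = -A := by
  symm
  rw [LinearMap.eq_adjoint_iff]
  intro x y
  simp [hA x y]

/-- Since `det A = det Aᵀ = det (-A) = (-1) ^ n * det A`, invertible skew maps only exist in even
dimension. -/
theorem IsSkew.even_finrank [FiniteDimensional ℝ V] {A : V →ₗ[ℝ] V} (hA : IsSkew A)
    (hinj : LinearMap.ker A = ⊥) : Even (finrank ℝ V) := by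
  by_contra hodd
  rw [Nat.not_even_iff_odd] at hodd
  have h1 : LinearMap.det (LinearMap.adjoint A) = LinearMap.det A := by
    let e := stdOrthonormalBasis ℝ V
    rw [← LinearMap.det_toMatrix e.toBasis, ← LinearMap.det_toMatrix e.toBasis A,
      LinearMap.toMatrix_adjoint, Matrix.det_conjTranspose, star_trivial]
  rw [hA.adjoint_eq, ← neg_one_smul ℝ A, LinearMap.det_smul, hodd.neg_one_pow] at h1
  have h2 : LinearMap.det A ≠ 0 := fun h ↦ by
    simpa [hinj] using LinearMap.bot_lt_ker_of_det_eq_zero h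
  exact h2 (by linarith)

theorem IsSkew.map_orthogonal {A : V →ₗ[ℝ] V} (hA : IsSkew A) {K : Submodule ℝ V}
    (hK : ∀ x ∈ K, A x ∈ K) {x : V} (hx : x ∈ Kᗮ) : A x ∈ Kᗮ := by
  rw [Submodule.mem_orthogonal] at hx ⊢
  intro u hu
  have := hA u x
  rw [hx _ (hK u hu)] at this
  linarith

/-- The kernel of a skew map has the parity of the ambient dimension, as the map is injective on
the orthogonal complement of its kernel. -/
theorem IsSkew.even_finrank_ker [FiniteDimensional ℝ V] {A : V →ₗ[ℝ] V} (hA : IsSkew A)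
    (hV : Even (finrank ℝ V)) :
    Even (finrank ℝ (LinearMap.ker A)) := by
  have hmaps : ∀ x ∈ (LinearMap.ker A)ᗮ, A x ∈ (LinearMap.ker A)ᗮ := fun x hx ↦
    hA.map_orthogonal (fun y hy ↦ by simp [LinearMap.mem_ker.1 hy]) hx
  have hskew : IsSkew (A.restrict hmaps) := fun x y ↦ by simpa using hA x y
  have heven := hskew.even_finrank (by
    rw [LinearMap.ker_eq_bot']
    intro x hx
    have h0 : A x = 0 := by simpa using congrArg Subtype.val hx
    have := Submodule.inner_right_of_mem_orthogonal (LinearMap.mem_ker.2 h0) x.2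
    exact Subtype.ext (inner_self_eq_zero.1 this))
  have := Submodule.finrank_add_finrank_orthogonal (LinearMap.ker A)
  rw [← this, Nat.even_add] at hV
  exact hV.2 heven

/-- If `J` and `N` are skew with `J * N = 0`, their ranges are orthogonal, so `J + N` kills only
what both kill; if moreover `N` is nonzero, then `N` does not vanish on the kernel of `J`. -/
theorem IsSkew.ker_add_lt {J N : V →ₗ[ℝ] V} (hJ : IsSkew J) (hN : IsSkew N)
    (hJN : ∀ x, J (N x) = 0) {v : V} (hv : N v ≠ 0) :
    LinearMap.ker (J + N) < LinearMap.ker J := by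
  have key : ∀ x, J x + N x = 0 → J x = 0 ∧ N x = 0 := by
    intro x hx
    have h1 : ⟪J x, N x⟫_ℝ = 0 := by rw [hJ, hJN]; simp
    have h2 : J x = -N x := eq_neg_of_add_eq_zero_left hx
    have h3 : N x = 0 := by
      rw [h2, inner_neg_left, neg_eq_zero] at h1
      exact inner_self_eq_zero.1 h1
    exact ⟨by rw [h2, h3, neg_zero], h3⟩
  refine lt_of_le_of_ne (fun x hx ↦ (key x hx).1) fun h ↦ ?_
  have h1 : N v ∈ LinearMap.ker (J + N) := h ▸ (hJN v)
  have h2 : N (N v) = 0 := (key _ h1).2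
  have h3 := hN (N v) v
  rw [h2] at h3
  simp at h3
  exact hv h3

/-- On an even-dimensional Euclidean space, a commuting family of skew maps commutes with some
invertible skew map. -/
theorem exists_isSkew_ker_eq_bot_commute [FiniteDimensional ℝ V] (hV : Even (finrank ℝ V))
    (S : Set (V →ₗ[ℝ] V))
    (hS : ∀ A ∈ S, IsSkew A) (hcomm : ∀ A ∈ S, ∀ B ∈ S, ∀ x, A (B x) = B (A x)) :
    ∃ J : V →ₗ[ℝ] V, IsSkew J ∧ LinearMap.ker J = ⊥ ∧ ∀ A ∈ S, ∀ x, A (J x) = J (A x) := by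
  classical
  -- Among the skew maps commuting with `S`, take one with the smallest kernel.
  obtain ⟨J, ⟨hJ, hJS⟩, hmin⟩ := exists_minimalFor_of_wellFoundedLT
    (fun J : V →ₗ[ℝ] V ↦ IsSkew J ∧ ∀ A ∈ S, ∀ x, A (J x) = J (A x))
    (fun J ↦ LinearMap.ker J) ⟨0, fun x y ↦ by simp, fun A _ x ↦ by simp⟩
  -- The kernel of `J` shrinks on adding `N`.
  have hcrit : ∀ N : V →ₗ[ℝ] V, IsSkew N → (∀ A ∈ S, ∀ x, A (N x) = N (A x)) →
      (∀ x, J (N x) = 0) → ∀ v, N v = 0 := by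
    intro N hN hNS hJN v
    by_contra hv
    have hlt := hJ.ker_add_lt hN hJN hv
    refine hlt.not_ge (hmin ⟨fun x y ↦ ?_, fun A hA x ↦ ?_⟩ hlt.le)
    · simp [inner_add_left, inner_add_right, hJ x y, hN x y]; ring
    · simp [hJS A hA, hNS A hA]
  refine ⟨J, hJ, ?_, hJS⟩
  set K := LinearMap.ker J with hK
  have hSK : ∀ A ∈ S, ∀ x ∈ K, A x ∈ K := fun A hA x hx ↦ by
    rw [hK, LinearMap.mem_ker] at hx ⊢
    rw [← hJS A hA, hx, map_zero]
  have hproj : ∀ A ∈ S, ∀ x, A (K.starProjection x) = K.starProjection (A x) := by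
    intro A hA x
    refine (Submodule.eq_starProjection_of_mem_of_inner_eq_zero
      (hSK A hA _ (Submodule.starProjection_apply_mem K x)) fun w hw ↦ ?_).symm
    rw [← map_sub]
    exact Submodule.inner_left_of_mem_orthogonal hw
      ((hS A hA).map_orthogonal (hSK A hA) (Submodule.sub_starProjection_mem_orthogonal x))
  -- By minimality every element of `S` vanishes on the kernel of `J`.
  have hSzero : ∀ A ∈ S, ∀ x ∈ K, A x = 0 := by
    intro A hA x hx
    have := hcrit (A ∘ₗ (K.starProjection : V →ₗ[ℝ] V)) (fun x y ↦ ?_) (fun B hB x ↦ ?_)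
      (fun x ↦ ?_) x
    · simpa [Submodule.starProjection_eq_self_iff.2 hx] using this
    · simp only [LinearMap.comp_apply, ContinuousLinearMap.coe_coe]
      rw [hS A hA, Submodule.inner_starProjection_left_eq_right, hproj A hA]
    · simp only [LinearMap.comp_apply, ContinuousLinearMap.coe_coe]
      rw [hcomm B hB A hA, hproj B hB]
    · simp only [LinearMap.comp_apply, ContinuousLinearMap.coe_coe]
      exact hSK A hA _ (Submodule.starProjection_apply_mem K x)
  -- If the kernel were nonzero, it would contain two orthonormal vectors, and the infinitesimal
  -- rotation of the plane they span could be added to `J`.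
  by_contra hne
  have hpos : 0 < finrank ℝ K := Nat.pos_of_ne_zero fun h ↦ hne (Submodule.finrank_eq_zero.1 h)
  have h2 : 1 < finrank ℝ K := by
    obtain ⟨m, hm⟩ := hJ.even_finrank_ker hV
    have : finrank ℝ K = m + m := hm
    omega
  let e := stdOrthonormalBasis ℝ K
  let i₀ : Fin (finrank ℝ K) := ⟨0, hpos⟩
  let i₁ : Fin (finrank ℝ K) := ⟨1, h2⟩
  let k : V := e i₀
  let l : V := e i₁
  have hkl : ⟪l, k⟫_ℝ = 0 := e.orthonormal.2 (i := i₁) (j := i₀) (by simp [i₀, i₁])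
  have hkk : ⟪k, k⟫_ℝ = 1 := by
    have : ‖k‖ = 1 := e.orthonormal.1 i₀
    rw [real_inner_self_eq_norm_sq, this, one_pow]
  have hl : l ≠ 0 := fun h ↦ e.orthonormal.ne_zero i₁ (Subtype.ext h)
  let N : V →ₗ[ℝ] V := (innerₛₗ ℝ k).smulRight l - (innerₛₗ ℝ l).smulRight k
  have hNx : ∀ x, N x = ⟪k, x⟫_ℝ • l - ⟪l, x⟫_ℝ • k := fun x ↦ by simp [N]
  have := hcrit N (fun x y ↦ ?_) (fun A hA x ↦ ?_) (fun x ↦ ?_) k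
  · rw [hNx, hkk, hkl] at this
    simp at this
    exact hl this
  · simp only [hNx, inner_sub_left, inner_sub_right, inner_smul_left, inner_smul_right,
      real_inner_comm x, RCLike.conj_to_real]
    ring
  · have hz : ∀ u ∈ K, ⟪u, A x⟫_ℝ = 0 := fun u hu ↦ by
      have := hS A hA u x
      rw [hSzero A hA u hu] at this
      simpa using this.symm
    rw [hNx, hNx, hz k (e i₀).2, hz l (e i₁).2, map_sub, map_smul, map_smul,
      hSzero A hA k (e i₀).2, hSzero A hA l (e i₁).2]
    simp
  · rw [hNx, map_sub, map_smul, map_smul, LinearMap.mem_ker.1 (e i₀).2,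
      LinearMap.mem_ker.1 (e i₁).2]
    simp

end SkewMaps

/-! ### Flat metrics on Lie algebras -/

section FlatProduct

/-- Let `D` be the covariant derivative of a flat metric on a Lie algebra with bracket
`[x, y] = D x y - D y x`. If the Lie algebra carries a positive definite invariant form `β`, then
`D = 0`. The identity map is a cocycle for the representation `D`, and averaging it over a
`β`-orthogonal basis gives a vector `w` with `D x w = C x`, where `C` is the Casimir operator of
`β`. Skewness turns this into `C w = 0`, whence `D w = 0`, `C = 0` and `D = 0`. -/
theorem flatProduct_eq_zero {W : Type*} [NormedAddCommGroup W] [InnerProductSpace ℝ W]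
    [FiniteDimensional ℝ W] (D : W →ₗ[ℝ] W →ₗ[ℝ] W) (hskew : ∀ x, IsSkew (D x))
    (hflat : ∀ x y z, D (D x y - D y x) z = D x (D y z) - D y (D x z))
    (β : LinearMap.BilinForm ℝ W) (hsymm : ∀ x y, β x y = β y x) (hpos : ∀ x, x ≠ 0 → 0 < β x x)
    (hinv : ∀ x y z, β (D x y - D y x) z = β x (D y z - D z y)) : D = 0 := by
  have : Invertible (2 : ℝ) := invertibleOfNonzero two_ne_zero
  obtain ⟨v, hv⟩ := LinearMap.BilinForm.exists_orthogonal_basis (B := β) ⟨fun x y ↦ hsymm x y⟩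
  let c : Fin (finrank ℝ W) → ℝ := fun i ↦ (β (v i) (v i))⁻¹
  have hc : ∀ i, 0 < c i := fun i ↦ inv_pos.2 (hpos _ (v.ne_zero i))
  have hexp : ∀ x, ∑ j, (c j * β (v j) x) • v j = x := by
    intro x
    conv_rhs => rw [← v.sum_repr x]
    refine Finset.sum_congr rfl fun j _ ↦ ?_
    congr 1
    conv_lhs => rw [← v.sum_repr x]
    rw [map_sum, Finset.sum_eq_single j]
    · have := (hpos _ (v.ne_zero j)).ne'
      simp only [map_smul, smul_eq_mul, c]
      field_simp
    · intro i _ hij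
      rw [map_smul, hv hij.symm, smul_zero]
    · simp
  let C : W →ₗ[ℝ] W := ∑ i, c i • (D (v i) ∘ₗ D (v i))
  have hC : ∀ x, C x = ∑ i, c i • D (v i) (D (v i) x) := fun x ↦ by simp [C, LinearMap.sum_apply]
  let w : W := ∑ i, c i • D (v i) (v i)
  -- These are the terms by which `D x w` and `C x` differ; they cancel, as
  -- `β (v j) [x, v i]` is antisymmetric in `i` and `j`.
  have hcancel : ∀ x, ∑ i, c i • (D (D x (v i) - D (v i) x) (v i)
      + D (v i) (D x (v i) - D (v i) x)) = 0 := by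
    intro x
    let m : Fin (finrank ℝ W) → Fin (finrank ℝ W) → ℝ := fun i j ↦
      β (v j) (D x (v i) - D (v i) x)
    have hm : ∀ i j, m i j = -m j i := by
      intro i j
      have h1 := hinv (v j) x (v i)
      have h2 : β (v i) (D x (v j) - D (v j) x) = -β (D (v j) x - D x (v j)) (v i) := by
        rw [hsymm, ← neg_sub (D (v j) x), map_neg, LinearMap.neg_apply]
      simp only [m]
      rw [h2, h1, neg_neg]
    let F : Fin (finrank ℝ W) → Fin (finrank ℝ W) → W := fun i j ↦
      (c i * c j * m i j) • (D (v j) (v i) + D (v i) (v j))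
    have h1 : ∑ i, c i • (D (D x (v i) - D (v i) x) (v i) + D (v i) (D x (v i) - D (v i) x))
        = ∑ i, ∑ j, F i j := by
      refine Finset.sum_congr rfl fun i _ ↦ ?_
      conv_lhs => rw [← hexp (D x (v i) - D (v i) x)]
      simp only [map_sum, LinearMap.sum_apply, map_smul, LinearMap.smul_apply]
      rw [← Finset.sum_add_distrib, Finset.smul_sum]
      refine Finset.sum_congr rfl fun j _ ↦ ?_
      simp only [F, m]
      module
    have h2 : ∑ i, ∑ j, F i j = -∑ i, ∑ j, F i j := by
      conv_lhs => rw [Finset.sum_comm]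
      rw [← Finset.sum_neg_distrib]
      refine Finset.sum_congr rfl fun i _ ↦ ?_
      rw [← Finset.sum_neg_distrib]
      refine Finset.sum_congr rfl fun j _ ↦ ?_
      simp only [F]
      rw [hm j i]
      module
    rw [h1]
    have h3 : (2 : ℝ) • ∑ i, ∑ j, F i j = 0 := by
      rw [two_smul]
      exact eq_neg_iff_add_eq_zero.1 h2
    exact (smul_eq_zero.1 h3).resolve_left two_ne_zero
  have hw : ∀ x, D x w = C x := by
    intro x
    have h1 : D x w = C x + ∑ i, c i • (D (D x (v i) - D (v i) x) (v i)
        + D (v i) (D x (v i) - D (v i) x)) := by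
      rw [hC, ← Finset.sum_add_distrib]
      simp only [w, map_sum, map_smul]
      refine Finset.sum_congr rfl fun i _ ↦ ?_
      rw [hflat, map_sub]
      module
    rw [h1, hcancel, add_zero]
  have hCsymm : ∀ x y, ⟪C x, y⟫_ℝ = ⟪x, C y⟫_ℝ := by
    intro x y
    simp only [hC, sum_inner, inner_sum, inner_smul_left, inner_smul_right, RCLike.conj_to_real]
    refine Finset.sum_congr rfl fun i _ ↦ ?_
    rw [hskew, hskew, neg_neg]
  have hCzero : ∀ y, C y = 0 → ∀ x, D x y = 0 := by
    intro y hy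
    have h1 : ∑ i, c i * ⟪D (v i) y, D (v i) y⟫_ℝ = 0 := by
      have : ⟪C y, y⟫_ℝ = -∑ i, c i * ⟪D (v i) y, D (v i) y⟫_ℝ := by
        rw [hC, sum_inner, ← Finset.sum_neg_distrib]
        refine Finset.sum_congr rfl fun i _ ↦ ?_
        rw [inner_smul_left, hskew, RCLike.conj_to_real]
        ring
      rw [hy, inner_zero_left] at this
      linarith
    have h2 : ∀ i, D (v i) y = 0 := by
      intro i
      have := (Finset.sum_eq_zero_iff_of_nonneg (fun i _ ↦
        mul_nonneg (hc i).le real_inner_self_nonneg)).1 h1 i (Finset.mem_univ i)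
      exact inner_self_eq_zero.1 ((mul_eq_zero.1 this).resolve_left (hc i).ne')
    intro x
    rw [← v.sum_repr x, map_sum, LinearMap.sum_apply]
    exact Finset.sum_eq_zero fun i _ ↦ by rw [map_smul, LinearMap.smul_apply, h2, smul_zero]
  have hCw : C w = 0 := by
    refine ext_inner_left ℝ fun x ↦ ?_
    rw [← hCsymm, ← hw, (hskew x).inner_self, inner_zero_right]
  ext x y
  exact hCzero y (by rw [← hw]; exact hCzero w hCw y) x

/-- For skew `A`, `-tr (A²)` is the sum of the `‖A (e i)‖²` over an orthonormal basis `e`. -/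
theorem neg_trace_comp_self_pos {V : Type*} [NormedAddCommGroup V] [InnerProductSpace ℝ V]
    [FiniteDimensional ℝ V] {A : V →ₗ[ℝ] V} (hA : IsSkew A) (hne : A ≠ 0) :
    0 < -LinearMap.trace ℝ V (A ∘ₗ A) := by
  let e := stdOrthonormalBasis ℝ V
  have h : -LinearMap.trace ℝ V (A ∘ₗ A) = ∑ i, ‖A (e i)‖ ^ 2 := by
    rw [LinearMap.trace_eq_sum_inner _ e, ← Finset.sum_neg_distrib]
    refine Finset.sum_congr rfl fun i _ ↦ ?_
    rw [← real_inner_self_eq_norm_sq, hA (e i), LinearMap.comp_apply]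
  rw [h]
  refine (Finset.sum_nonneg fun i _ ↦ sq_nonneg _).lt_of_ne' fun h0 ↦ hne ?_
  refine e.toBasis.ext fun i ↦ ?_
  have := (Finset.sum_eq_zero_iff_of_nonneg (fun i _ ↦ sq_nonneg _)).1 h0 i (Finset.mem_univ i)
  simpa using this

/-- The operators `D x` of a flat metric on a Lie algebra commute. The kernel of `D` and its
orthogonal complement `W` are invariant, and `-tr (D x * D y)` is an invariant inner product on
`W`, so that `D x y = 0` for `x` and `y` in `W`. -/
theorem flatProduct_commute {V : Type*} [NormedAddCommGroup V] [InnerProductSpace ℝ V]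
    [FiniteDimensional ℝ V] (D : V →ₗ[ℝ] V →ₗ[ℝ] V) (hskew : ∀ x, IsSkew (D x))
    (hflat : ∀ x y z, D (D x y - D y x) z = D x (D y z) - D y (D x z)) (x y z : V) :
    D x (D y z) = D y (D x z) := by
  have hker : ∀ x, ∀ u ∈ LinearMap.ker D, D x u ∈ LinearMap.ker D := by
    intro x u hu
    rw [LinearMap.mem_ker] at hu ⊢
    ext z
    simpa [hu] using hflat x u z
  have hmem : ∀ x y : (LinearMap.ker D)ᗮ, D x y ∈ (LinearMap.ker D)ᗮ := fun x y ↦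
    (hskew x).map_orthogonal (hker x) y.2
  let D' : (LinearMap.ker D)ᗮ →ₗ[ℝ] (LinearMap.ker D)ᗮ →ₗ[ℝ] (LinearMap.ker D)ᗮ :=
    LinearMap.mk₂ ℝ (fun x y ↦ ⟨D x y, hmem x y⟩) (fun _ _ _ ↦ Subtype.ext (by simp))
      (fun _ _ _ ↦ Subtype.ext (by simp)) (fun _ _ _ ↦ Subtype.ext (by simp))
      (fun _ _ _ ↦ Subtype.ext (by simp))
  have hD' : ∀ x y : (LinearMap.ker D)ᗮ, (D' x y : V) = D x y := fun x y ↦ rfl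
  let β : LinearMap.BilinForm ℝ (LinearMap.ker D)ᗮ :=
    LinearMap.mk₂ ℝ (fun x y ↦ -LinearMap.trace ℝ V (D x ∘ₗ D y))
      (fun _ _ _ ↦ by simp [LinearMap.add_comp]; ring)
      (fun _ _ _ ↦ by simp [LinearMap.smul_comp])
      (fun _ _ _ ↦ by simp [LinearMap.comp_add]; ring)
      (fun _ _ _ ↦ by simp [LinearMap.comp_smul])
  have hβ : ∀ x y, β x y = -LinearMap.trace ℝ V (D x * D y) := fun x y ↦ rfl
  have hbr : ∀ x y : (LinearMap.ker D)ᗮ, D ((D' x y - D' y x : (LinearMap.ker D)ᗮ) : V)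
      = D x * D y - D y * D x := fun x y ↦ by
    ext z
    simpa [hD'] using hflat x y z
  have hzero : D' = 0 := by
    refine flatProduct_eq_zero D' (fun x y z ↦ hskew x y z)
      (fun x y z ↦ Subtype.ext (hflat x y z)) β (fun x y ↦ ?_) (fun x hx ↦ ?_) (fun x y z ↦ ?_)
    · rw [hβ, hβ, LinearMap.trace_mul_comm]
    · refine neg_trace_comp_self_pos (hskew x) fun h ↦ hx ?_
      have := Submodule.inner_right_of_mem_orthogonal (LinearMap.mem_ker.2 h) x.2
      exact Subtype.ext (inner_self_eq_zero.1 this)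
    · rw [hβ, hβ, hbr, hbr, sub_mul, mul_sub, map_sub, map_sub, mul_assoc (D (y : V)),
        LinearMap.trace_mul_comm ℝ (D (y : V)), mul_assoc, mul_assoc]
  have hproj : ∀ x, ∃ x' : (LinearMap.ker D)ᗮ, D x = D x' := by
    intro x
    refine ⟨⟨_, Submodule.sub_starProjection_mem_orthogonal (K := LinearMap.ker D) x⟩, ?_⟩
    have := LinearMap.mem_ker.1 (Submodule.starProjection_apply_mem (LinearMap.ker D) x)
    simp [this]
  obtain ⟨x', hx⟩ := hproj x
  obtain ⟨y', hy⟩ := hproj y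
  have h1 := hflat x' y' z
  rw [← hD', ← hD', hzero] at h1
  rw [hx, hy]
  exact sub_eq_zero.1 (by simpa using h1.symm)

/-- A flat metric on an even-dimensional Lie algebra admits a nondegenerate alternating form which
is invariant under all `D x`. The metric is `B`, and the form is presented as
`∑ i, B u (a i) * B v (b i)`, which extends at once to a smooth form on the group. -/
theorem exists_invariant_twoForm {V : Type*} [AddCommGroup V] [Module ℝ V] [FiniteDimensional ℝ V]
    (hdim : Even (finrank ℝ V)) (B : V →ₗ[ℝ] V →ₗ[ℝ] ℝ) (hsymm : ∀ x y, B x y = B y x)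
    (hpos : ∀ x, x ≠ 0 → 0 < B x x) (D : V →ₗ[ℝ] V →ₗ[ℝ] V)
    (hmetric : ∀ x y z, B (D x y) z + B y (D x z) = 0)
    (hflat : ∀ x y z, D (D x y - D y x) z = D x (D y z) - D y (D x z)) :
    ∃ (n : ℕ) (a b : Fin n → V),
      (∀ u, ∑ i, B u (a i) * B u (b i) = 0) ∧
      (∀ u, (∀ v, ∑ i, B u (a i) * B v (b i) = 0) → u = 0) ∧
      ∀ x u v, ∑ i, B (D x u) (a i) * B v (b i) + ∑ i, B u (a i) * B (D x v) (b i) = 0 := by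
  let core : InnerProductSpace.Core ℝ V :=
    { inner := fun x y ↦ B x y
      conj_inner_symm := fun x y ↦ by simp [hsymm x y]
      re_inner_nonneg := fun x ↦ by
        rcases eq_or_ne x 0 with rfl | hx
        · simp
        · simpa using (hpos x hx).le
      add_left := fun x y z ↦ by simp
      smul_left := fun x y r ↦ by simp
      definite := fun x hx ↦ by
        by_contra h
        exact (hpos x h).ne' hx }
  let _ : NormedAddCommGroup V := core.toNormedAddCommGroup
  let _ : InnerProductSpace ℝ V := InnerProductSpace.ofCore core.toCore
  have hB : ∀ x y, ⟪x, y⟫_ℝ = B x y := fun x y ↦ rfl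
  have hskew : ∀ x, IsSkew (D x) := fun x y z ↦ by
    rw [hB, hB]; linarith [hmetric x y z]
  obtain ⟨J, hJ, hJker, hJD⟩ := exists_isSkew_ker_eq_bot_commute hdim (Set.range D)
    (by rintro _ ⟨x, rfl⟩; exact hskew x)
    (by rintro _ ⟨x, rfl⟩ _ ⟨y, rfl⟩ z; exact flatProduct_commute D hskew hflat x y z)
  let e := stdOrthonormalBasis ℝ V
  have hsum : ∀ u v, ∑ i, B u (J (e i)) * B v (e i) = -⟪J u, v⟫_ℝ := by
    intro u v
    rw [← e.sum_inner_mul_inner (J u) v, ← Finset.sum_neg_distrib]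
    refine Finset.sum_congr rfl fun i _ ↦ ?_
    rw [hJ, real_inner_comm v, hB, hB]
    ring
  refine ⟨_, fun i ↦ J (e i), e, fun u ↦ ?_, fun u hu ↦ ?_, fun x u v ↦ ?_⟩
  · rw [hsum, hJ.inner_self, neg_zero]
  · have h0 : J u = 0 := by
      have := hu (J u)
      rw [hsum, neg_eq_zero] at this
      exact inner_self_eq_zero.1 this
    exact LinearMap.ker_eq_bot'.1 hJker u h0
  · rw [hsum, hsum, ← hJD _ ⟨x, rfl⟩, hskew]
    ring

end FlatProduct

/-! ### Smooth and parallel 2-forms -/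

section Forms

variable {E : Type*} [NormedAddCommGroup E] [NormedSpace ℝ E]
  {H : Type*} [TopologicalSpace H] {I : ModelWithCorners ℝ E H}
  {M : Type*} [TopologicalSpace M] [ChartedSpace H M]

theorem contMDiffAt_smulRight {F₁ F₂ : Type*} [NormedAddCommGroup F₁] [NormedSpace ℝ F₁]
    [NormedAddCommGroup F₂] [NormedSpace ℝ F₂] {f : M → F₁ →L[ℝ] ℝ} {h : M → F₂} {x : M}
    (hf : ContMDiffAt I 𝓘(ℝ, F₁ →L[ℝ] ℝ) ∞ f x) (hh : ContMDiffAt I 𝓘(ℝ, F₂) ∞ h x) :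
    ContMDiffAt I 𝓘(ℝ, F₁ →L[ℝ] F₂) ∞ (fun y ↦ (f y).smulRight (h y)) x :=
  (isBoundedBilinearMap_smulRight (𝕜 := ℝ) (E := F₁) (F := F₂)).contDiff.comp_contMDiffAt
    (hf.prodMk_space hh)

variable [IsManifold I ∞ M]

/-- The tensor product of two smooth 1-forms is smooth. -/
theorem contMDiff_smulRight {φ ψ : Π x : M, TangentSpace I x →L[ℝ] ℝ}
    (hφ : ContMDiff I (I.prod 𝓘(ℝ, E →L[ℝ] ℝ)) ∞
      (fun x ↦ TotalSpace.mk' (E →L[ℝ] ℝ) (E := fun x : M ↦ TangentSpace I x →L[ℝ] ℝ) x (φ x)))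
    (hψ : ContMDiff I (I.prod 𝓘(ℝ, E →L[ℝ] ℝ)) ∞
      (fun x ↦ TotalSpace.mk' (E →L[ℝ] ℝ) (E := fun x : M ↦ TangentSpace I x →L[ℝ] ℝ) x (ψ x))) :
    ContMDiff I (I.prod 𝓘(ℝ, E →L[ℝ] E →L[ℝ] ℝ)) ∞
      (fun x ↦ TotalSpace.mk' (E →L[ℝ] E →L[ℝ] ℝ)
        (E := fun x : M ↦ TangentSpace I x →L[ℝ] TangentSpace I x →L[ℝ] ℝ) x
        ((φ x).smulRight (ψ x))) := by
  intro x₀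
  have h1 := (contMDiffAt_hom_bundle _).1 (hφ x₀)
  have h2 := (contMDiffAt_hom_bundle _).1 (hψ x₀)
  refine (contMDiffAt_hom_bundle _).2 ⟨contMDiffAt_id, ?_⟩
  have h3 := contMDiffAt_smulRight h1.2 h2.2
  refine h3.congr_of_eventuallyEq ?_
  filter_upwards [(trivializationAt E (TangentSpace I : M → Type _) x₀).open_baseSet.mem_nhds
    (FiberBundle.mem_baseSet_trivializationAt' x₀)] with x hx
  ext v w
  rw [inCoordinates_apply_eq₂ hx hx (Set.mem_univ _), ContinuousLinearMap.smulRight_apply,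
    smul_apply,
    ContinuousLinearMap.inCoordinates_eq hx (Set.mem_univ _),
    ContinuousLinearMap.inCoordinates_eq hx (Set.mem_univ _)]
  simp

/-- The defect of `∇Ω = 0` is tensorial, so that it suffices to test it on vector fields which
span every tangent space. -/
theorem TwoForm.isParallel_of_spanning [FiniteDimensional ℝ E] (Ω : TwoForm I M)
    (nabla : Connection I M) {ι : Type*} (F : ι → Π x : M, TangentSpace I x)
    (hF : ∀ i, IsSmoothField (F i)) (hspan : ∀ (x : M) (u : TangentSpace I x), ∃ i, F i x = u)
    (hpar : ∀ (i j : ι) (x : M) (u : TangentSpace I x),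
      mvfderiv I (fun y ↦ Ω.form y (F i y) (F j y)) x u
        = Ω.form x (nabla (F i) x u) (F j x) + Ω.form x (F i x) (nabla (F j) x u)) :
    Ω.IsParallel nabla := by
  intro X Y Z _ hY hZ x
  have hmd : ∀ {Y : Π x : M, TangentSpace I x}, IsSmoothField Y →
      MDifferentiableAt I I.tangent (fun x ↦ (⟨x, Y x⟩ : TangentBundle I M)) x :=
    fun h ↦ (h x).mdifferentiableAt (by simp)
  have hΩ : ∀ {Y Z : Π x : M, TangentSpace I x},
      MDifferentiableAt I I.tangent (fun x ↦ (⟨x, Y x⟩ : TangentBundle I M)) x →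
      MDifferentiableAt I I.tangent (fun x ↦ (⟨x, Z x⟩ : TangentBundle I M)) x →
      MDifferentiableAt I 𝓘(ℝ, ℝ) (fun y ↦ Ω.form y (Y y) (Z y)) x := by
    intro Y Z hY hZ
    have := MDifferentiableAt.clm_bundle_apply₂ (F₁ := E) (F₂ := E) (F₃ := ℝ)
      (E₃ := Bundle.Trivial M ℝ)
      ((Ω.contMDiff x).mdifferentiableAt (by simp)) hY hZ
    rw [mdifferentiableAt_totalSpace] at this
    exact this.2
  -- The defect of parallelism in the direction `X x`.
  let Φ (Y Z : Π x : M, TangentSpace I x) : ℝ :=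
    mvfderiv I (fun y ↦ Ω.form y (Y y) (Z y)) x (X x)
      - (Ω.form x (nabla Y x (X x)) (Z x) + Ω.form x (Y x) (nabla Z x (X x)))
  obtain ⟨i, hi⟩ := hspan x (Y x)
  obtain ⟨j, hj⟩ := hspan x (Z x)
  have hΦ : Φ Y Z = Φ (F i) (F j) := by
    refine TensorialAt.pointwise₂ (I := I) (F := E) (F' := E) (Φ := Φ)
      (fun Z hZ ↦ ⟨fun {f σ} hf hσ ↦ ?_, fun {σ σ'} hσ hσ' ↦ ?_⟩)
      (fun Y hY ↦ ⟨fun {f σ} hf hσ ↦ ?_, fun {σ σ'} hσ hσ' ↦ ?_⟩)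
      (hmd hY) (hmd (hF i)) (hmd hZ) (hmd (hF j)) hi.symm hj.symm
    · simp [Φ, mvfderiv_fun_mul hf (hΩ hσ hZ), nabla.isCovariantDerivativeOn.leibniz hσ hf]
      ring
    · simp [Φ, mvfderiv_fun_add (hΩ hσ hZ) (hΩ hσ' hZ),
        nabla.isCovariantDerivativeOn.add hσ hσ']
      ring
    · simp [Φ, mvfderiv_fun_mul hf (hΩ hY hσ), nabla.isCovariantDerivativeOn.leibniz hσ hf]
      ring
    · simp [Φ, mvfderiv_fun_add (hΩ hY hσ) (hΩ hY hσ'),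
        nabla.isCovariantDerivativeOn.add hσ hσ']
      ring
  refine sub_eq_zero.1 (hΦ.trans ?_)
  simp only [Φ, hpar, sub_self]

end Forms

/-! ### Left-invariant vector fields -/

section LeftInvariantFields

variable {E : Type*} [NormedAddCommGroup E] [NormedSpace ℝ E]
  {H : Type*} [TopologicalSpace H] {I : ModelWithCorners ℝ E H}
  {G : Type*} [TopologicalSpace G] [ChartedSpace H G] [Group G]

/-- The left-invariant vector field with value `v` at the identity. -/
abbrev leftField (v : GroupLieAlgebra I G) (x : G) : TangentSpace I x :=
  mulInvariantVectorField v x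

theorem leftField_one (v : GroupLieAlgebra I G) : leftField v (1 : G) = v := by
  have h : (fun c : G ↦ 1 * c) = id := by ext; simp
  simp only [leftField, mulInvariantVectorField]
  rw [h, mfderiv_id]
  rfl

theorem leftField_add (u v : GroupLieAlgebra I G) (x : G) :
    leftField (u + v) x = leftField u x + leftField v x :=
  congrFun (mulInvariantVectorField_add u v) x

theorem leftField_smul (c : ℝ) (v : GroupLieAlgebra I G) (x : G) :
    leftField (c • v) x = c • leftField v x :=
  congrFun (mulInvariantVectorField_smul c v) x

theorem IsLeftInvariant.apply_leftField
    {B : Π x : G, TangentSpace I x →L[ℝ] TangentSpace I x →L[ℝ] ℝ} (hB : IsLeftInvariant B)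
    (x : G) (u v : GroupLieAlgebra I G) : B x (leftField u x) (leftField v x) = B 1 u v := by
  -- Left-invariance speaks of the tangent space at `x * 1`, which is `E` like the one at `x`.
  have key : ∀ (y : G), x * 1 = y → ∀ p q : E,
      B (x * 1) (p : TangentSpace I (x * 1)) (q : TangentSpace I (x * 1))
        = B y (p : TangentSpace I y) (q : TangentSpace I y) := by
    rintro _ rfl p q
    rfl
  exact (key x (mul_one x) _ _).symm.trans (hB x 1 u v)

variable [LieGroup I ∞ G]

/-- The field `x ↦ d(x * ·) v` is the image of the smooth map `x ↦ ((x, 0), (1, v))` from `G` to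
`TG × TG` under the differential of the multiplication. -/
theorem isSmoothField_leftField (v : GroupLieAlgebra I G) :
    IsSmoothField (leftField (I := I) (G := G) v) := by
  let fg : G → TangentBundle I G := fun g ↦ TotalSpace.mk' E g 0
  have sfg : ContMDiff I I.tangent ∞ fg := contMDiff_zeroSection _ _
  let fv : G → TangentBundle I G := fun _ ↦ TotalSpace.mk' E 1 v
  have sfv : ContMDiff I I.tangent ∞ fv := contMDiff_const
  let F₁ : G → (TangentBundle I G × TangentBundle I G) := fun g ↦ (fg g, fv g)
  have S₁ : ContMDiff I (I.tangent.prod I.tangent) ∞ F₁ := sfg.prodMk sfv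
  let F₂ : (TangentBundle I G × TangentBundle I G) → TangentBundle (I.prod I) (G × G) :=
    (equivTangentBundleProd I G I G).symm
  have S₂ : ContMDiff (I.tangent.prod I.tangent) (I.prod I).tangent ∞ F₂ :=
    contMDiff_equivTangentBundleProd_symm
  let F₃ : TangentBundle (I.prod I) (G × G) → TangentBundle I G :=
    tangentMap (I.prod I) I (fun (p : G × G) ↦ p.1 * p.2)
  have S₃ : ContMDiff (I.prod I).tangent I.tangent ∞ F₃ :=
    ContMDiff.contMDiff_tangentMap (contMDiff_mul I ∞) (m := ∞) (by simp)
  have S := (S₃.comp S₂).comp S₁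
  unfold IsSmoothField leftField
  convert! S with g
  · simp [F₁, F₂, F₃, fg, fv]
  · simp only [Function.comp_apply, tangentMap, F₃, F₂, F₁, fg, fv]
    rw [mfderiv_prod_eq_add_apply ((contMDiff_mul I ∞).mdifferentiableAt (by simp))]
    change mfderiv I I (fun x ↦ g * x) 1 v
      = mfderiv I I (fun z ↦ z * 1) g 0 + mfderiv I I (fun z ↦ g * z) 1 v
    rw [map_zero]
    exact (zero_add (M := E) _).symm

theorem mdifferentiableAt_leftMul (a b : G) :
    MDifferentiableAt I I (fun c ↦ a * c) b :=
  (contMDiff_mul_left (I := I) (n := ∞)).contMDiffAt.mdifferentiableAt (by simp)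

theorem mfderiv_leftField (a b : G) (v : GroupLieAlgebra I G) :
    mfderiv I I (fun c ↦ a * c) b (leftField v b) = leftField v (a * b) := by
  have h : (fun c : G ↦ a * b * c) = (fun c ↦ a * c) ∘ (fun c ↦ b * c) := by
    ext c; simp [mul_assoc]
  simp only [leftField, mulInvariantVectorField]
  rw [h, mfderiv_comp_of_eq (I' := I) (mdifferentiableAt_leftMul a b)
    (mdifferentiableAt_leftMul b 1) (mul_one b)]
  -- The tangent spaces at `b` and `b * 1` are both `E`, which allows to compare these derivatives.
  have key : ∀ y, y = b → ∀ w : E, (mfderiv I I (fun c ↦ a * c) b (w : TangentSpace I b) : E)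
      = mfderiv I I (fun c ↦ a * c) y (w : TangentSpace I y) := by
    rintro _ rfl w
    rfl
  exact key (b * 1) (mul_one b) _

theorem exists_leftField_eq (x : G) (u : TangentSpace I x) :
    ∃ v : GroupLieAlgebra I G, leftField v x = u := by
  -- The chain rule inverts the derivative of `c ↦ x * c` at `x⁻¹ * x` rather than at `1`.
  have key : ∀ y : G, y = 1 → (∀ u : TangentSpace I x, ∃ v : TangentSpace I y,
      mfderiv I I (fun c ↦ x * c) y v = u) → ∃ v : TangentSpace I (1 : G),
      mfderiv I I (fun c ↦ x * c) (1 : G) v = u := by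
    rintro _ rfl h
    exact h u
  refine key (x⁻¹ * x) (inv_mul_cancel x) fun u ↦
    ⟨mfderiv I I (fun c ↦ x⁻¹ * c) x u, ?_⟩
  have h : (fun c : G ↦ x * c) ∘ (fun c ↦ x⁻¹ * c) = id := by ext c; simp
  have h2 := mfderiv_comp (I' := I) x (mdifferentiableAt_leftMul (I := I) x (x⁻¹ * x))
    (mdifferentiableAt_leftMul (I := I) x⁻¹ x)
  rw [h, mfderiv_id] at h2
  exact (congrArg (fun L ↦ L u) h2).symm

end LeftInvariantFields

/-! ### Left-invariant flat metrics -/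

section FlatLieGroups

variable {E : Type*} [NormedAddCommGroup E] [NormedSpace ℝ E]
  {H : Type*} [TopologicalSpace H] {I : ModelWithCorners ℝ E H}
  {G : Type*} [TopologicalSpace G] [ChartedSpace H G] [Group G] [LieGroup I ∞ G]
  {g : Metric I G} {nabla : Connection I G}

/-- The 2-form `∑ i, g(X_{a i}, ·) ⊗ g(X_{b i}, ·)`, where `X_v` is the left-invariant field with
value `v` at the identity. The hypothesis says that it is alternating at the identity. Written with
the metric and the smooth fields `X_v`, the form is visibly smooth. -/
def leftTwoForm (g : Metric I G) (hinv : IsLeftInvariant g.inner) {n : ℕ}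
    (a b : Fin n → GroupLieAlgebra I G)
    (halt : ∀ u, ∑ i, g.inner 1 u (a i) * g.inner 1 u (b i) = 0) : TwoForm I G where
  form x := ∑ i, (g.inner x (leftField (a i) x)).smulRight (g.inner x (leftField (b i) x))
  alternating x u := by
    obtain ⟨v, rfl⟩ := exists_leftField_eq x u
    rw [← halt v]
    simp [hinv.apply_leftField, g.symm 1 v]
  contMDiff := by
    have h : ∀ v : GroupLieAlgebra I G, ContMDiff I (I.prod 𝓘(ℝ, E →L[ℝ] ℝ)) ∞
        (fun x ↦ TotalSpace.mk' (E →L[ℝ] ℝ) (E := fun x : G ↦ TangentSpace I x →L[ℝ] ℝ) x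
          (g.inner x (leftField v x))) :=
      fun v ↦ g.contMDiff.clm_bundle_apply (isSmoothField_leftField v)
    exact ContMDiff.sum_section fun i _ ↦ contMDiff_smulRight (h (a i)) (h (b i))

theorem leftTwoForm_leftField (hinv : IsLeftInvariant g.inner) {n : ℕ}
    (a b : Fin n → GroupLieAlgebra I G)
    (halt : ∀ u, ∑ i, g.inner 1 u (a i) * g.inner 1 u (b i) = 0) (u v : GroupLieAlgebra I G)
    (x : G) : (leftTwoForm g hinv a b halt).form x (leftField u x) (leftField v x)
      = ∑ i, g.inner 1 u (a i) * g.inner 1 v (b i) := by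
  simp [leftTwoForm, hinv.apply_leftField, g.symm 1 u, g.symm 1 v]

variable [FiniteDimensional ℝ E]

/-- Vanishing of the torsion; the bracket is that of the Lie algebra of `G`. -/
theorem IsLeviCivita.sub_leftField (hLC : IsLeviCivita g nabla) (u v : GroupLieAlgebra I G)
    (x : G) : nabla (leftField v) x (leftField u x) - nabla (leftField u) x (leftField v x)
      = leftField ⁅u, v⁆ x := by
  have : CompleteSpace E := FiniteDimensional.complete ℝ E
  have : LieGroup I (minSmoothness ℝ 3) G := by
    rw [minSmoothness_of_isRCLikeNormedField]
    infer_instance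
  rw [(nabla.torsion_eq_zero_iff).1 hLC.2
    ((isSmoothField_leftField u x).mdifferentiableAt (by simp))
    ((isSmoothField_leftField v x).mdifferentiableAt (by simp))]
  exact (congrFun (mulInvariantVector_mlieBracket u v) x).symm

/-- For left-invariant fields, the metric compatibility has no derivative term. -/
theorem IsLeviCivita.inner_add_inner_eq_zero (hLC : IsLeviCivita g nabla)
    (hinv : IsLeftInvariant g.inner) (u v w : GroupLieAlgebra I G) (x : G) :
    g.inner x (nabla (leftField v) x (leftField u x)) (leftField w x)
      + g.inner x (leftField v x) (nabla (leftField w) x (leftField u x)) = 0 := by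
  rw [← hLC.1 _ _ _ (isSmoothField_leftField u) (isSmoothField_leftField v)
    (isSmoothField_leftField w)]
  simp only [hinv.apply_leftField]
  rw [mvfderiv_const]
  rfl

/-- Koszul's formula for left-invariant fields. -/
theorem IsLeviCivita.koszul (hLC : IsLeviCivita g nabla) (hinv : IsLeftInvariant g.inner)
    (u v w : GroupLieAlgebra I G) (x : G) :
    2 * g.inner x (nabla (leftField v) x (leftField u x)) (leftField w x)
      = g.inner 1 ⁅u, v⁆ w - g.inner 1 ⁅v, w⁆ u + g.inner 1 ⁅w, u⁆ v := by
  have hskew : ∀ u v w : GroupLieAlgebra I G,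
      g.inner x (nabla (leftField v) x (leftField u x)) (leftField w x)
        = -g.inner x (nabla (leftField w) x (leftField u x)) (leftField v x) := by
    intro u v w
    have := hLC.inner_add_inner_eq_zero hinv u v w x
    rw [g.symm x (leftField v x)] at this
    linarith
  have htor : ∀ u v w : GroupLieAlgebra I G, g.inner 1 ⁅u, v⁆ w
      = g.inner x (nabla (leftField v) x (leftField u x)) (leftField w x)
        - g.inner x (nabla (leftField u) x (leftField v x)) (leftField w x) := by
    intro u v w
    rw [← hinv.apply_leftField x, ← hLC.sub_leftField, map_sub, sub_apply]
  rw [htor u v w, htor v w u, htor w u v]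
  linarith [hskew u v w, hskew v u w, hskew w u v]

/-- The covariant derivative of left-invariant fields is left-invariant. -/
theorem IsLeviCivita.nabla_leftField (hLC : IsLeviCivita g nabla) (hinv : IsLeftInvariant g.inner)
    (u v : GroupLieAlgebra I G) (x : G) : nabla (leftField v) x (leftField u x)
      = leftField (nabla (leftField v) 1 u : GroupLieAlgebra I G) x := by
  -- Otherwise, test Koszul's formula at `x` and at `1` on the left-invariant extension of the
  -- difference of both sides.
  by_contra hne
  obtain ⟨w, hw⟩ := exists_leftField_eq x (nabla (leftField v) x (leftField u x)
    - leftField (nabla (leftField v) 1 u : GroupLieAlgebra I G) x)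
  refine (g.pos x _ (sub_ne_zero.2 hne)).ne' ?_
  have h1 := hLC.koszul hinv u v w x
  have h2 := hLC.koszul hinv u v w 1
  rw [leftField_one, leftField_one] at h2
  nth_rw 2 [← hw]
  rw [map_sub, sub_apply, hinv.apply_leftField]
  linarith

/-- The product `(u, v) ↦ ∇_u v` on the Lie algebra. -/
def leftProduct (nabla : Connection I G) :
    GroupLieAlgebra I G →ₗ[ℝ] GroupLieAlgebra I G →ₗ[ℝ] GroupLieAlgebra I G :=
  LinearMap.mk₂ ℝ (fun u v ↦ nabla (leftField v) 1 u)
    (fun u u' v ↦ map_add _ _ _)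
    (fun c u v ↦ map_smul _ _ _)
    (fun u v v' ↦ by
      have h : (leftField (v + v') : Π x : G, TangentSpace I x) = leftField v + leftField v' :=
        funext (leftField_add v v')
      rw [h, nabla.isCovariantDerivativeOn.add
        ((isSmoothField_leftField v 1).mdifferentiableAt (by simp))
        ((isSmoothField_leftField v' 1).mdifferentiableAt (by simp))]
      rfl)
    (fun c u v ↦ by
      have h : (leftField (c • v) : Π x : G, TangentSpace I x) = c • leftField v :=
        funext (leftField_smul c v)
      rw [h, nabla.isCovariantDerivativeOn.smul_const c
        ((isSmoothField_leftField v 1).mdifferentiableAt (by simp))]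
      rfl)

theorem IsLeviCivita.leftProduct_flat (hLC : IsLeviCivita g nabla)
    (hinv : IsLeftInvariant g.inner)
    (hflat : ∀ X Y Z : Π x : G, TangentSpace I x, IsSmoothField X → IsSmoothField Y →
      IsSmoothField Z → ∀ x : G, curvature nabla X Y Z x = 0) (u v w : GroupLieAlgebra I G) :
    leftProduct nabla (leftProduct nabla u v - leftProduct nabla v u) w
      = leftProduct nabla u (leftProduct nabla v w)
        - leftProduct nabla v (leftProduct nabla u w) := by
  have h := hflat _ _ _ (isSmoothField_leftField u) (isSmoothField_leftField v)
    (isSmoothField_leftField w) 1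
  have hfield : ∀ u v : GroupLieAlgebra I G, (fun y ↦ nabla (leftField v) y (leftField u y))
      = leftField (leftProduct nabla u v) := fun u v ↦ funext (hLC.nabla_leftField hinv u v)
  have hbr : VectorField.mlieBracket I (leftField u) (leftField v) (1 : G)
      = leftProduct nabla u v - leftProduct nabla v u := by
    have := hLC.sub_leftField u v 1
    rw [leftField_one, leftField_one, leftField_one] at this
    exact this.symm
  rw [curvature, hfield, hfield, hbr, leftField_one, leftField_one] at h
  exact (sub_eq_zero.1 h).symm

end FlatLieGroups

end RiemannianLieGroup

end

theorem mainTheorem5 {E : Type*} [NormedAddCommGroup E] [NormedSpace ℝ E] [FiniteDimensional ℝ E]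
    {G : Type*} [TopologicalSpace G] [ChartedSpace E G] [Group G] [LieGroup 𝓘(ℝ, E) ∞ G]
    (hdim : Even (Module.finrank ℝ E))
    (g : RiemannianLieGroup.Metric 𝓘(ℝ, E) G)
    (hinv : RiemannianLieGroup.IsLeftInvariant g.inner)
    (hflat : RiemannianLieGroup.IsFlat g) :
    ∃ Ω : RiemannianLieGroup.TwoForm 𝓘(ℝ, E) G,
      RiemannianLieGroup.IsLeftInvariant Ω.form ∧ RiemannianLieGroup.IsKahler g Ω := by
  open RiemannianLieGroup in
  obtain ⟨nabla, hLC, hcurv⟩ := hflat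
  have hmetric := fun u v w ↦ hLC.inner_add_inner_eq_zero hinv u v w 1
  simp only [leftField_one] at hmetric
  have : FiniteDimensional ℝ (GroupLieAlgebra 𝓘(ℝ, E) G) := inferInstanceAs (FiniteDimensional ℝ E)
  have hdim' : Even (Module.finrank ℝ (GroupLieAlgebra 𝓘(ℝ, E) G)) := hdim
  let B : GroupLieAlgebra 𝓘(ℝ, E) G →ₗ[ℝ] GroupLieAlgebra 𝓘(ℝ, E) G →ₗ[ℝ] ℝ :=
    LinearMap.mk₂ ℝ (fun u v ↦ g.inner 1 u v) (by simp) (by simp) (by simp) (by simp)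
  obtain ⟨n, a, b, halt, hnondeg, hDinv⟩ := exists_invariant_twoForm
    (V := GroupLieAlgebra 𝓘(ℝ, E) G) hdim' B (g.symm 1) (g.pos 1) (leftProduct nabla) hmetric
    (hLC.leftProduct_flat hinv hcurv)
  replace halt : ∀ u, ∑ i, g.inner 1 u (a i) * g.inner 1 u (b i) = 0 := halt
  have hform := leftTwoForm_leftField hinv a b halt
  refine ⟨leftTwoForm g hinv a b halt, fun x y u v ↦ ?_, fun x u hu ↦ ?_, nabla, hLC, ?_⟩
  · obtain ⟨u, rfl⟩ := exists_leftField_eq y u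
    obtain ⟨v, rfl⟩ := exists_leftField_eq y v
    rw [mfderiv_leftField, mfderiv_leftField, hform, hform]
  · obtain ⟨u, rfl⟩ := exists_leftField_eq x u
    have h0 : u = 0 := hnondeg u fun v ↦ (hform u v x).symm.trans (hu (leftField v x))
    rw [h0]
    exact map_zero _
  · refine TwoForm.isParallel_of_spanning _ nabla leftField isSmoothField_leftField
      exists_leftField_eq fun v w x u ↦ ?_
    obtain ⟨u, rfl⟩ := exists_leftField_eq x u
    rw [hLC.nabla_leftField hinv, hLC.nabla_leftField hinv]
    simp only [hform]
    rw [mvfderiv_const]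
    exact (hDinv u v w).symm
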